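/- Fix a prime power $q$ and an integer $k \ge 1$. For an integer $m \ge 1$ let $\mathcal{I}_m$ be the set of polynomials $x \in \mathbb{F}_q[T]$ with $\deg x < m$ (where $\deg 0 = -\infty$). For a nonzero $F \in \mathbb{F}_q[T]$ and $x \in \mathbb{F}_q[T]$ coprime to $F$, let $\overline{x}$ denote the multiplicative inverse of $x$ modulo $F$, and let $E^{\mathrm{inv}}_{F,k}(\mathcal{I}_m)$ be the number of $2k$-tuples $(x_1,\dots,x_{2k}) \in \mathcal{I}_m^{2k}$, with every $x_i$ coprime to $F$, such that $$\overline{x_1} + \cdots + \overline{x_k} \equiv \overline{x_{k+1}} + \cdots + \overline{x_{2k}} \pmod F.$$ Then there is a function $e \colon \mathbb{N} \to \mathbb{R}$, depending only on $q$ and $k$, with $e(m) = o(m)$ as $m \to \infty$, such that for every $F \in \mathbb{F}_q[T]$ of degree $r$ and every integer $m$ with $1 \le m \le r$, $$E^{\mathrm{inv}}_{F,k}(\mathcal{I}_m) \le q^{km + e(m)} + q^{m(3k-1) - r + e(m)}.$$ -/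

import Mathlib

open Polynomial Asymptotics Filter

/-- The interval `I_m` of polynomials `x ∈ K[T]` with `|x| < q ^ m`, that is, with `deg x < m`
(where `deg 0 = -∞`). -/
def polyInterval (K : Type*) [Field K] (m : ℕ) : Set K[X] :=
  {x | x.degree < (m : WithBot ℕ)}

/-- The multiplicative inverse of `x` modulo `F`, as an element of `K[T] / (F)`.
It is only used for `x` coprime to `F`, where it is the actual inverse. -/
noncomputable def invMod {K : Type*} [Field K] (F x : K[X]) : K[X] ⧸ Ideal.span {F} :=
  Ring.inverse (Ideal.Quotient.mk (Ideal.span {F}) x)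

/-- The solutions `(x₁, …, x_k), (x_{k+1}, …, x_{2k})` of the congruence
`x̄₁ + ⋯ + x̄_k ≡ x̄_{k+1} + ⋯ + x̄_{2k} (mod F)` with all variables in `S` and coprime to `F`
(so that the inverses exist). -/
def invSolutions {K : Type*} [Field K] (F : K[X]) (k : ℕ) (S : Set K[X]) :
    Set ((Fin k → K[X]) × (Fin k → K[X])) :=
  {p | (∀ i, p.1 i ∈ S ∧ IsCoprime (p.1 i) F) ∧ (∀ i, p.2 i ∈ S ∧ IsCoprime (p.2 i) F) ∧
    ∑ i, invMod F (p.1 i) = ∑ i, invMod F (p.2 i)}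

/-- The number of solutions of the congruence with inverses, for a finite set `S`. -/
noncomputable def invEnergy {K : Type*} [Field K] (F : K[X]) (k : ℕ) (S : Set K[X]) : ℕ :=
  (invSolutions F k S).ncard

/-- Over a finite field the intervals are finite. -/
theorem polyInterval_finite (K : Type*) [Field K] [Finite K] (m : ℕ) :
    (polyInterval K m).Finite := by
  have : Finite (degreeLT K m) := Finite.of_equiv _ (degreeLTEquiv K m).symm.toEquiv
  refine (Set.toFinite (degreeLT K m : Set K[X])).subset fun x hx => ?_
  exact mem_degreeLT.2 hx

/-- For finite `S` there are finitely many solutions, so that `invEnergy` is their true number. -/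
theorem invSolutions_finite {K : Type*} [Field K] (F : K[X]) (k : ℕ) {S : Set K[X]}
    (hS : S.Finite) : (invSolutions F k S).Finite := by
  have h : (Set.univ.pi fun _ : Fin k => S).Finite := Set.Finite.pi fun _ => hS
  exact (h.prod h).subset fun p hp => ⟨fun i _ => (hp.1 i).1, fun i _ => (hp.2.1 i).1⟩

/-! Write `∑ 1 / x i` as a fraction `N_x / P_x` with `P_x = ∏ x i`. Clearing denominators turns the
congruence into `F ∣ N_x P_y - P_x N_y`, and the solutions are split according to whether this
determinant vanishes.

If it vanishes, the equality holds in `K(T)`, and every prime dividing `P_x P_y` divides it twice.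
So `P_x P_y = A² B` with `B ∣ A` (`exists_sq_mul_of_squarefull`). Then `deg A < km` leaves at most
`q^(km)` choices of `A`, and the divisor bound (`exists_divisor_bound`) leaves `q^o(m)` choices of
`B` and of all the variables.

If it does not vanish, fix `x` in at most `q^(km)` ways. The vectors `(N_y, P_y)` lie in the part of
a lattice of determinant `F` inside a box with sides `u ≈ (k-1)m` and `v ≈ km`. Since they are not
all proportional, a Minkowski-type bound (`finrank_add_natDegree_le`) gives at most `q^(u+v-r)` of
them, and by the divisor bound each comes from `q^o(m)` tuples `y`. -/

/-! ### The divisor bound in `K[T]`. -/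

open UniqueFactorizationMonoid in
/-- The number of divisors of a nonzero polynomial over a finite field, in terms of the
multiplicities of its irreducible factors. -/
theorem ncard_dvd_le_prod_count {K : Type*} [Field K] [Finite K] [DecidableEq K] [DecidableEq K[X]] {A : K[X]}
    (hA : A ≠ 0) :
    {D | D ∣ A}.ncard ≤ Nat.card K *
      ∏ p ∈ (normalizedFactors A).toFinset, ((normalizedFactors A).count p + 1) := by
  classical
  have := Fintype.ofFinite K
  rw [← Multiset.card_Iic, Nat.card_eq_fintype_card, ← Finset.card_univ, ← Finset.card_product,
    ← Set.ncard_coe_finset]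
  refine Set.ncard_le_ncard_of_injOn (fun D => (D.leadingCoeff, normalizedFactors D)) ?_ ?_
    (Finset.finite_toSet _)
  · intro D hD
    have hD0 : D ≠ 0 := ne_zero_of_dvd_ne_zero hA hD
    simpa using (dvd_iff_normalizedFactors_le_normalizedFactors hD0 hA).1 hD
  · intro D _ E _ h
    simp only [Prod.mk.injEq] at h
    rw [← Polynomial.leadingCoeff_mul_prod_normalizedFactors D,
      ← Polynomial.leadingCoeff_mul_prod_normalizedFactors E, h.1, h.2]

open UniqueFactorizationMonoid in
theorem sum_count_mul_natDegree_normalizedFactors {K : Type*} [Field K] [DecidableEq K] [DecidableEq K[X]]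
    {A : K[X]} (hA : A ≠ 0) :
    ∑ p ∈ (normalizedFactors A).toFinset, (normalizedFactors A).count p * p.natDegree =
      A.natDegree := by
  have h := Polynomial.leadingCoeff_mul_prod_normalizedFactors A
  conv_rhs => rw [← h]
  rw [natDegree_C_mul (leadingCoeff_ne_zero.2 hA), natDegree_multiset_prod _ (zero_notMem_normalizedFactors A),
    Finset.sum_multiset_map_count]
  simp

theorem polyInterval_eq_degreeLT (K : Type*) [Field K] (m : ℕ) :
    polyInterval K m = (degreeLT K m : Set K[X]) := by
  ext x; simp [polyInterval, mem_degreeLT]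

theorem ncard_polyInterval (K : Type*) [Field K] [Finite K] (m : ℕ) :
    (polyInterval K m).ncard = Nat.card K ^ m := by
  rw [polyInterval_eq_degreeLT, ← Nat.card_coe_set_eq]
  change Nat.card (degreeLT K m) = _
  rw [Nat.card_congr (degreeLTEquiv K m).toEquiv, Nat.card_fun]
  simp

theorem mem_polyInterval_of_natDegree_lt {K : Type*} [Field K] {m : ℕ} {x : K[X]}
    (h : x.natDegree < m) : x ∈ polyInterval K m :=
  lt_of_le_of_lt degree_le_natDegree (by exact_mod_cast h)

theorem natDegree_lt_of_mem_polyInterval {K : Type*} [Field K] {m : ℕ} {x : K[X]}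
    (hx : x ≠ 0) (h : x ∈ polyInterval K m) : x.natDegree < m :=
  (natDegree_lt_iff_degree_lt hx).2 h

-- Irreducible factors are split at degree `N`. There are at most `q ^ N` small ones, each with
-- multiplicity at most `n`; the large ones have total multiplicity at most `n / N`, and `c + 1 ≤ 2
-- ^ c`. The leading factor `q` counts the unit multiples.
open UniqueFactorizationMonoid in
theorem ncard_dvd_le {K : Type*} [Field K] [Finite K] {A : K[X]} (hA : A ≠ 0) {n N : ℕ}
    (hN : 0 < N) (hn : A.natDegree ≤ n) :
    {D | D ∣ A}.ncard ≤ Nat.card K * ((n + 1) ^ (Nat.card K ^ N) * 2 ^ (n / N)) := by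
  classical
  refine (ncard_dvd_le_prod_count hA).trans (Nat.mul_le_mul_left _ ?_)
  have hsum := sum_count_mul_natDegree_normalizedFactors hA
  set s := normalizedFactors A
  have hdeg : ∀ p ∈ s.toFinset, 0 < p.natDegree := fun p hp =>
    (irreducible_of_normalized_factor p (Multiset.mem_toFinset.1 hp)).natDegree_pos
  rw [← Finset.prod_filter_mul_prod_filter_not _ (fun p : K[X] => p.natDegree < N)]
  refine Nat.mul_le_mul ?_ ?_
  · have hle : ∀ p ∈ s.toFinset.filter (fun p => p.natDegree < N), s.count p + 1 ≤ n + 1 := by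
      intro p hp
      have hp := (Finset.mem_filter.1 hp).1
      have := Finset.single_le_sum (f := fun p => s.count p * p.natDegree)
        (fun _ _ => Nat.zero_le _) hp
      have h1 := Nat.le_mul_of_pos_right (s.count p) (hdeg p hp)
      omega
    refine (Finset.prod_le_pow_card _ _ _ hle).trans (Nat.pow_le_pow_right (by omega) ?_)
    rw [← ncard_polyInterval, ← Set.ncard_coe_finset]
    refine Set.ncard_le_ncard (fun p hp => ?_) (polyInterval_finite K N)
    exact mem_polyInterval_of_natDegree_lt (Finset.mem_filter.1 hp).2
  · have hle : ∀ p ∈ s.toFinset.filter (fun p => ¬ p.natDegree < N),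
        s.count p + 1 ≤ 2 ^ s.count p := fun p _ => Nat.lt_two_pow_self
    refine (Finset.prod_le_prod' hle).trans ?_
    rw [Finset.prod_pow_eq_pow_sum]
    refine Nat.pow_le_pow_right (by omega) ((Nat.le_div_iff_mul_le hN).2 ?_)
    rw [Finset.sum_mul]
    refine le_trans ?_ (hsum.le.trans hn)
    refine (Finset.sum_le_sum (g := fun p => s.count p * p.natDegree) fun p hp => ?_).trans
      (Finset.sum_le_sum_of_subset (Finset.filter_subset _ _))
    exact Nat.mul_le_mul_left _ (not_lt.1 (Finset.mem_filter.1 hp).2)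

theorem finite_dvd {K : Type*} [Field K] [Finite K] {A : K[X]} (hA : A ≠ 0) :
    {D | D ∣ A}.Finite :=
  (polyInterval_finite K (A.natDegree + 1)).subset fun _ hD =>
    mem_polyInterval_of_natDegree_lt (Nat.lt_succ_of_le (natDegree_le_of_dvd hD hA))

/-- The divisor bound: a nonzero polynomial of degree at most `n` has at most `q ^ o(n)`
divisors. -/
theorem exists_divisor_bound (K : Type*) [Field K] [Finite K] :
    ∃ g : ℕ → ℝ, (∀ n, 0 ≤ g n) ∧ g =o[atTop] (fun n : ℕ => (n : ℝ)) ∧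
      ∀ (A : K[X]) (n : ℕ), A ≠ 0 → A.natDegree ≤ n →
        ({D | D ∣ A}.ncard : ℝ) ≤ (Nat.card K : ℝ) ^ g n := by
  set q := Nat.card K
  have hq : 1 < q := Finite.one_lt_card
  have hqR : (1 : ℝ) < q := by exact_mod_cast hq
  have hq2 : (2 : ℝ) ≤ q := by exact_mod_cast hq
  let S : ℕ → Set ℕ := fun n => {t | ∃ A : K[X], A ≠ 0 ∧ A.natDegree ≤ n ∧ t = {D | D ∣ A}.ncard}
  have hbound : ∀ n N, 0 < N → ∀ t ∈ S n, t ≤ q * ((n + 1) ^ (q ^ N) * 2 ^ (n / N)) := by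
    rintro n N hN t ⟨A, hA, hn, rfl⟩
    exact ncard_dvd_le hA hN hn
  -- Boundedness matters because `sSup` of an unbounded set of naturals is `0`; any `N` will do
  -- here.
  have hbdd : ∀ n, BddAbove (S n) := fun n => ⟨_, hbound n 1 one_pos⟩
  have hmem1 : ∀ n, {D : K[X] | D ∣ 1}.ncard ∈ S n := fun n => ⟨1, one_ne_zero, by simp, rfl⟩
  have hpos : ∀ n, 1 ≤ sSup (S n) := fun n => by
    refine le_trans ?_ (le_csSup (hbdd n) (hmem1 n))
    exact (Set.ncard_pos (finite_dvd one_ne_zero)).2 ⟨1, dvd_rfl⟩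
  have hposR : ∀ n, (1 : ℝ) ≤ (sSup (S n) : ℕ) := fun n => by exact_mod_cast hpos n
  refine ⟨fun n => Real.logb q (sSup (S n) : ℕ), ?_, ?_, ?_⟩
  · exact fun n => Real.logb_nonneg hqR (hposR n)
  · rw [isLittleO_iff]
    intro c hc
    -- With `N > 2 / c` the large factors cost at most `c / 2 * n`; once `N` is fixed the rest is
    -- `O(log n)` and fits in the other half.
    obtain ⟨N, hN⟩ := exists_nat_gt (2 / c)
    have hN0 : (0 : ℝ) < N := lt_trans (by positivity) hN
    have hNn : 0 < N := by exact_mod_cast hN0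
    have hlogq : 0 < Real.log q := Real.log_pos hqR
    have hlo : (fun n : ℕ => 1 + (q ^ N : ℕ) * (Real.log ((n : ℝ) + 1) / Real.log q))
        =o[atTop] (fun n : ℕ => (n : ℝ)) := by
      have h1 : (fun _ : ℕ => (1 : ℝ)) =o[atTop] (fun n : ℕ => (n : ℝ)) :=
        (isLittleO_const_id_atTop (1 : ℝ)).comp_tendsto tendsto_natCast_atTop_atTop
      have h2 : (fun n : ℕ => Real.log ((n : ℝ) + 1)) =o[atTop] (fun n : ℕ => (n : ℝ)) := by
        have h3 : (fun n : ℕ => Real.log ((n : ℝ) + 1)) =o[atTop] (fun n : ℕ => (n : ℝ) + 1) :=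
          Real.isLittleO_log_id_atTop.comp_tendsto
            (tendsto_atTop_add_const_right _ (1 : ℝ) tendsto_natCast_atTop_atTop)
        exact h3.trans_isBigO ((isBigO_refl _ _).add h1.isBigO)
      refine h1.add ?_
      have := h2.const_mul_left ((q ^ N : ℕ) / Real.log q)
      refine this.congr_left fun n => by ring
    filter_upwards [isLittleO_iff.1 hlo (half_pos hc)] with n hn
    have hle : (sSup (S n) : ℕ) ≤ q * ((n + 1) ^ (q ^ N) * 2 ^ (n / N)) :=
      csSup_le ⟨_, hmem1 n⟩ (hbound n N hNn)
    have hleR : ((sSup (S n) : ℕ) : ℝ) ≤ q * (((n : ℝ) + 1) ^ (q ^ N) * 2 ^ (n / N)) := by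
      exact_mod_cast hle
    have hlog := Real.logb_le_logb_of_le hqR (by linarith [hposR n]) hleR
    have hn1 : (0 : ℝ) < (n : ℝ) + 1 := by positivity
    rw [Real.logb_mul (by positivity) (by positivity), Real.logb_mul (by positivity) (by positivity),
      Real.logb_self_eq_one hqR, Real.logb_pow, Real.logb_pow] at hlog
    have h2 : Real.logb q 2 ≤ 1 := by
      rw [← Real.logb_self_eq_one hqR]
      exact Real.logb_le_logb_of_le hqR (by norm_num) hq2
    have h3 : ((n / N : ℕ) : ℝ) * Real.logb q 2 ≤ c / 2 * n := by
      have h4 : ((n / N : ℕ) : ℝ) ≤ n / N := Nat.cast_div_le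
      have h5 : (n : ℝ) / N ≤ c / 2 * n := by
        rw [div_le_iff₀ hN0]
        have : 1 ≤ c / 2 * N := by
          rw [div_lt_iff₀ hc] at hN; linarith
        nlinarith [(Nat.cast_nonneg n : (0 : ℝ) ≤ n)]
      calc ((n / N : ℕ) : ℝ) * Real.logb q 2 ≤ ((n / N : ℕ) : ℝ) * 1 :=
            mul_le_mul_of_nonneg_left h2 (Nat.cast_nonneg _)
        _ ≤ _ := by linarith
    rw [Real.norm_of_nonneg (Real.logb_nonneg hqR (hposR n)), Real.norm_of_nonneg (Nat.cast_nonneg n)]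
    rw [Real.norm_of_nonneg (Nat.cast_nonneg n)] at hn
    have hn' := (le_abs_self _).trans hn
    rw [Real.logb] at hlog ⊢
    rw [Real.logb] at hlog
    linarith
  · intro A n hA hn
    rw [Real.rpow_logb (by linarith) hqR.ne' (by linarith [hposR n])]
    exact Nat.cast_le.2 (le_csSup (hbdd n) ⟨A, hA, hn, rfl⟩)

/-! ### Geometry of numbers in rank two over `K[T]`. -/

/-- The `2 × 2` determinant `p₁ q₂ - q₁ p₂`, as a linear map in `q`. -/
noncomputable def crossLeft {K : Type*} [Field K] (p : K[X] × K[X]) : K[X] × K[X] →ₗ[K] K[X] :=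
  LinearMap.mulLeft K p.1 ∘ₗ LinearMap.snd K _ _ - LinearMap.mulLeft K p.2 ∘ₗ LinearMap.fst K _ _

theorem crossLeft_apply {K : Type*} [Field K] (p q : K[X] × K[X]) :
    crossLeft p q = p.1 * q.2 - p.2 * q.1 := by
  simp [crossLeft]

/-- Plücker-type relation: vectors proportional to a common nonzero vector are proportional. -/
theorem crossLeft_eq_zero_of_crossLeft_eq_zero {K : Type*} [Field K] {w p q : K[X] × K[X]}
    (hw : w ≠ 0) (hp : crossLeft w p = 0) (hq : crossLeft w q = 0) : crossLeft p q = 0 := by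
  rw [crossLeft_apply] at *
  by_cases h1 : w.1 = 0
  · have h2 : w.2 ≠ 0 := fun h2 => hw (Prod.ext h1 h2)
    simp only [h1, zero_mul, zero_sub, neg_eq_zero, mul_eq_zero, h2, false_or] at hp hq
    simp [hp, hq]
  · refine (mul_eq_zero.1 (?_ : w.1 * _ = 0)).resolve_left h1
    linear_combination p.1 * hq - q.1 * hp

theorem crossLeft_swap {K : Type*} [Field K] (p q : K[X] × K[X]) :
    crossLeft p.swap q.swap = - crossLeft p q := by
  simp [crossLeft_apply]

theorem finrank_degreeLT (K : Type*) [Field K] (n : ℕ) :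
    Module.finrank K (degreeLT K n) = n := by
  rw [(degreeLTEquiv K n).finrank_eq]; simp

instance finite_degreeLT (K : Type*) [Field K] (n : ℕ) :
    Module.Finite K (degreeLT K n) := Module.Finite.equiv (degreeLTEquiv K n).symm

theorem mem_degreeLT_of_natDegree_lt {K : Type*} [Field K] {n : ℕ} {x : K[X]}
    (h : x ≠ 0 → x.natDegree < n) : x ∈ degreeLT K n := by
  rw [mem_degreeLT]
  by_cases hx : x = 0
  · simp [hx]
  · exact (natDegree_lt_iff_degree_lt hx).1 (h hx)

theorem natDegree_lt_of_mem_degreeLT {K : Type*} [Field K] {n : ℕ} {x : K[X]}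
    (h : x ∈ degreeLT K n) (hx : x ≠ 0) : x.natDegree < n :=
  (natDegree_lt_iff_degree_lt hx).2 (mem_degreeLT.1 h)

/-- The multiples of `F` among the polynomials of degree `< n` form a space of dimension at most
`n - deg F`. -/
theorem finrank_le_sub_of_dvd {K : Type*} [Field K] {F : K[X]} (hF : F ≠ 0) {n : ℕ}
    (W : Submodule K K[X]) (hW : W ≤ degreeLT K n) (hdvd : ∀ x ∈ W, F ∣ x) :
    Module.finrank K W ≤ n - F.natDegree := by
  have hle : W ≤ (degreeLT K (n - F.natDegree)).map (LinearMap.mulLeft K F) := by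
    intro x hx
    obtain ⟨y, rfl⟩ := hdvd x hx
    refine ⟨y, mem_degreeLT_of_natDegree_lt fun hy => ?_, rfl⟩
    have := natDegree_lt_of_mem_degreeLT (hW hx) (mul_ne_zero hF hy)
    rw [natDegree_mul hF hy] at this
    omega
  refine (Submodule.finrank_mono hle).trans ?_
  exact (Submodule.finrank_map_le _ _).trans (finrank_degreeLT K _).le

/-- A space of vectors proportional to a shortest vector `w` whose second coordinate realizes its
length. -/
theorem finrank_le_of_crossLeft_eq_zero {K : Type*} [Field K] {u v s : ℕ}
    (Z : Submodule K (K[X] × K[X])) (hZ : ∀ p ∈ Z, p.2 ∈ degreeLT K v)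
    (hs : ∀ p ∈ Z, p.1 ∈ degreeLT K (u - (s + 1)) → p.2 ∈ degreeLT K (v - (s + 1)) → p = 0)
    {w : K[X] × K[X]} (hw : ∀ p ∈ Z, crossLeft w p = 0) (hw1 : w.1 ∈ degreeLT K (u - s))
    (hw0 : w.2 ≠ 0) (hw2 : w.2 ∉ degreeLT K (v - (s + 1))) :
    Module.finrank K Z ≤ s + 1 := by
  -- The top `s + 1` coefficients of the second coordinate determine the vector: if they vanish,
  -- proportionality to `w` makes the first coordinate short too, and `hs` forces zero.
  let φ : K[X] × K[X] →ₗ[K] (Fin (s + 1) → K) :=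
    LinearMap.pi fun i => lcoeff K (v - (s + 1) + i) ∘ₗ LinearMap.snd K _ _
  have hφ : ∀ p ∈ Z, φ p = 0 → p = 0 := by
    intro p hp h
    have hpw' := hw p hp
    rw [crossLeft_apply] at hpw'
    have hcoeff : ∀ i : Fin (s + 1), p.2.coeff (v - (s + 1) + i) = 0 := fun i => congrFun h i
    have h2 : p.2 ∈ degreeLT K (v - (s + 1)) := by
      rw [mem_degreeLT, degree_lt_iff_coeff_zero]
      intro j hj
      by_cases hjv : j < v
      · have := hcoeff ⟨j - (v - (s + 1)), by omega⟩
        simpa [Nat.add_sub_cancel' hj] using this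
      · exact (degree_lt_iff_coeff_zero _ _).1 (mem_degreeLT.1 (hZ p hp)) j (not_lt.1 hjv)
    have h1 : p.1 ∈ degreeLT K (u - (s + 1)) := by
      refine mem_degreeLT_of_natDegree_lt fun hp1 => ?_
      have hne : w.2 * p.1 ≠ 0 := mul_ne_zero hw0 hp1
      have heq : w.1 * p.2 = w.2 * p.1 := sub_eq_zero.1 hpw'
      have hne' := hne
      rw [← heq] at hne'
      have hd := congrArg natDegree heq
      rw [natDegree_mul (left_ne_zero_of_mul hne') (right_ne_zero_of_mul hne'),
        natDegree_mul hw0 hp1] at hd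
      have e1 := natDegree_lt_of_mem_degreeLT hw1 (left_ne_zero_of_mul hne')
      have e2 := natDegree_lt_of_mem_degreeLT h2 (right_ne_zero_of_mul hne')
      have e3 : v - (s + 1) ≤ w.2.natDegree := by
        by_contra hcon
        exact hw2 (mem_degreeLT_of_natDegree_lt fun _ => not_le.1 hcon)
      omega
    exact hs p hp h1 h2
  have hinj : Function.Injective (φ.domRestrict Z) := by
    intro a b hab
    refine Subtype.ext (sub_eq_zero.1 (hφ _ (Z.sub_mem a.2 b.2) ?_))
    rw [map_sub, sub_eq_zero]
    exact hab
  simpa using LinearMap.finrank_le_finrank_of_injective hinj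

/-- Rank-nullity for `crossLeft w` on `L`, with `w` a shortest vector. The kernel consists of the
vectors proportional to `w` and has dimension at most `s + 1`. The image consists of multiples of
`F` of degree below `u + v - (s + 1)`, because `w` is shorter than the box by `s`. The two
occurrences of `s + 1` cancel. -/
theorem finrank_add_natDegree_le_of_shortest {K : Type*} [Field K] {F : K[X]} (hF : F ≠ 0)
    {u v s : ℕ} (L : Submodule K (K[X] × K[X]))
    (hL : ∀ p ∈ L, p.1 ∈ degreeLT K u ∧ p.2 ∈ degreeLT K v)
    (hdvd : ∀ p ∈ L, ∀ q ∈ L, F ∣ crossLeft p q)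
    (hs : ∀ p ∈ L, p.1 ∈ degreeLT K (u - (s + 1)) → p.2 ∈ degreeLT K (v - (s + 1)) → p = 0)
    {w : K[X] × K[X]} (hw : w ∈ L) (hw1 : w.1 ∈ degreeLT K (u - s))
    (hw2 : w.2 ∈ degreeLT K (v - s)) (hw0 : w.2 ≠ 0)
    (hw2' : w.2 ∉ degreeLT K (v - (s + 1)))
    (hrank : ∃ q ∈ L, crossLeft w q ≠ 0) :
    Module.finrank K L + F.natDegree ≤ u + v := by
  have hle : L ≤ (degreeLT K u).prod (degreeLT K v) := fun p hp => hL p hp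
  have : Module.Finite K ↥((degreeLT K u).prod (degreeLT K v)) :=
    Module.Finite.iff_fg.2 ((Module.Finite.iff_fg.1 (finite_degreeLT K u)).prod
      (Module.Finite.iff_fg.1 (finite_degreeLT K v)))
  have : Module.Finite K L := Submodule.finiteDimensional_of_le hle
  have hker : Module.finrank K ↥(LinearMap.ker ((crossLeft w).domRestrict L)) ≤ s + 1 := by
    rw [← Submodule.finrank_map_subtype_eq]
    have hmem : ∀ p ∈ (LinearMap.ker ((crossLeft w).domRestrict L)).map L.subtype,
        p ∈ L ∧ crossLeft w p = 0 := by
      rintro _ ⟨p, hp, rfl⟩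
      exact ⟨p.2, hp⟩
    exact finrank_le_of_crossLeft_eq_zero _ (fun p hp => (hL p (hmem p hp).1).2)
      (fun p hp => hs p (hmem p hp).1) (fun p hp => (hmem p hp).2) hw1 hw0 hw2'
  have hsum := LinearMap.finrank_range_add_finrank_ker ((crossLeft w).domRestrict L)
  have hdeg : ∀ q ∈ L, crossLeft w q ∈ degreeLT K (u + v - (s + 1)) := by
    intro q hq
    rw [crossLeft_apply]
    have hv := natDegree_lt_of_mem_degreeLT hw2 hw0
    refine Submodule.sub_mem _ ?_ ?_
    · refine mem_degreeLT_of_natDegree_lt fun h => ?_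
      have e1 := natDegree_lt_of_mem_degreeLT hw1 (left_ne_zero_of_mul h)
      have e2 := natDegree_lt_of_mem_degreeLT (hL q hq).2 (right_ne_zero_of_mul h)
      have := natDegree_mul_le (p := w.1) (q := q.2)
      omega
    · refine mem_degreeLT_of_natDegree_lt fun h => ?_
      have e2 := natDegree_lt_of_mem_degreeLT (hL q hq).1 (right_ne_zero_of_mul h)
      have := natDegree_mul_le (p := w.2) (q := q.1)
      omega
  have hrange : Module.finrank K ↥(LinearMap.range ((crossLeft w).domRestrict L)) ≤
      u + v - (s + 1) - F.natDegree := by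
    refine finrank_le_sub_of_dvd hF _ ?_ ?_
    · rintro _ ⟨q, rfl⟩
      exact hdeg q q.2
    · rintro _ ⟨q, rfl⟩
      exact hdvd w hw q q.2
  -- A nonzero determinant shows `deg F < u + v - (s + 1)`, so the subtraction in `hrange` is not
  -- truncated.
  obtain ⟨q, hq, hne⟩ := hrank
  have h1 := natDegree_lt_of_mem_degreeLT (hdeg q hq) hne
  have h2 := natDegree_le_of_dvd (hdvd w hw q hq) hne
  omega

/-- A form of Minkowski's second theorem in dimension two over `K[T]`: the points in a box of a
lattice of determinant `F` form a space of dimension at most `u + v - deg F`, unless they are all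
proportional. -/
theorem finrank_add_natDegree_le {K : Type*} [Field K] {F : K[X]} (hF : F ≠ 0)
    {u v : ℕ} (L : Submodule K (K[X] × K[X]))
    (hL : ∀ p ∈ L, p.1 ∈ degreeLT K u ∧ p.2 ∈ degreeLT K v)
    (hdvd : ∀ p ∈ L, ∀ q ∈ L, F ∣ crossLeft p q)
    (hrank : ∃ p ∈ L, ∃ q ∈ L, crossLeft p q ≠ 0) :
    Module.finrank K L + F.natDegree ≤ u + v := by
  classical
  obtain ⟨p, hp, q, hq, hpq⟩ := hrank
  have hp0 : p ≠ 0 := by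
    rintro rfl
    simp [crossLeft_apply] at hpq
  -- The least shrinking of both sides of the box that kills `L` is `s + 1`, so a nonzero `w`
  -- survives the shrinking by `s` and is a shortest vector.
  let Q : ℕ → Prop := fun s =>
    ∀ p ∈ L, p.1 ∈ degreeLT K (u - s) → p.2 ∈ degreeLT K (v - s) → p = 0
  have hQ : ∃ s, Q s := by
    refine ⟨u + v, fun p _ h1 h2 => Prod.ext ?_ ?_⟩
    · by_contra h
      have := natDegree_lt_of_mem_degreeLT h1 h
      omega
    · by_contra h
      have := natDegree_lt_of_mem_degreeLT h2 h
      omega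
  obtain ⟨s, hs⟩ : ∃ s, Nat.find hQ = s + 1 := by
    refine Nat.exists_eq_succ_of_ne_zero fun h0 => hp0 ?_
    have := Nat.find_spec hQ
    rw [h0] at this
    exact this p hp (hL p hp).1 (hL p hp).2
  have hmin : Q (s + 1) := hs ▸ Nat.find_spec hQ
  have hnot : ¬ Q s := Nat.find_min hQ (by omega)
  simp only [Q, not_forall] at hnot
  obtain ⟨w, hw, hw1, hw2, hw0⟩ := hnot
  have hrank' : ∃ q ∈ L, crossLeft w q ≠ 0 := by
    by_contra! h
    exact hpq (crossLeft_eq_zero_of_crossLeft_eq_zero hw0 (h p hp) (h q hq))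
  -- The length of `w` is realized by one of its coordinates; if only by the first, the coordinates
  -- are exchanged.
  by_cases h2 : w.2 ∈ degreeLT K (v - (s + 1))
  · have h1 : w.1 ∉ degreeLT K (u - (s + 1)) := fun h1 => hw0 (hmin w hw h1 h2)
    have h10 : w.1 ≠ 0 := fun h => h1 (h ▸ Submodule.zero_mem _)
    let e := LinearEquiv.prodComm K K[X] K[X]
    have hmem : ∀ p, p ∈ L.map (e : K[X] × K[X] →ₗ[K] K[X] × K[X]) ↔ p.swap ∈ L := by
      intro p
      constructor
      · rintro ⟨x, hx, rfl⟩
        exact hx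
      · exact fun h => ⟨p.swap, h, rfl⟩
    have hfin : Module.finrank K ↥(L.map (e : K[X] × K[X] →ₗ[K] K[X] × K[X])) =
        Module.finrank K L := LinearEquiv.finrank_map_eq e L
    rw [← hfin, add_comm u v]
    refine finrank_add_natDegree_le_of_shortest hF (s := s) (w := w.swap) _ ?_ ?_ ?_ ?_ hw2 hw1 h10
      h1 ?_
    · exact fun p hp => (hL _ ((hmem p).1 hp)).symm
    · intro p hp q hq
      rw [← p.swap_swap, ← q.swap_swap, crossLeft_swap, dvd_neg]
      exact hdvd _ ((hmem p).1 hp) _ ((hmem q).1 hq)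
    · intro p hp hp1 hp2
      exact Prod.swap_injective (hmin _ ((hmem p).1 hp) hp2 hp1)
    · exact (hmem _).2 hw
    · obtain ⟨q, hq, hne⟩ := hrank'
      refine ⟨q.swap, (hmem _).2 hq, ?_⟩
      rwa [crossLeft_swap, neg_ne_zero]
  · exact finrank_add_natDegree_le_of_shortest hF L hL hdvd hmin hw hw1 hw2
      (fun h => h2 (h ▸ Submodule.zero_mem _)) h2 hrank'

/-! ### Clearing denominators, and squarefull products. -/

/-- The numerator `∑ i, ∏ j ≠ i, x j` of `∑ i, 1 / x i` over the denominator `∏ i, x i`. -/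
noncomputable def recipNumerator {R : Type*} [CommRing R] {k : ℕ} (x : Fin k → R) : R :=
  ∑ i, ∏ j ∈ Finset.univ.erase i, x j

theorem mk_prod_mul_sum_invMod {K : Type*} [Field K] {F : K[X]} {k : ℕ} {x : Fin k → K[X]}
    (hx : ∀ i, IsCoprime (x i) F) :
    Ideal.Quotient.mk (Ideal.span {F}) (∏ i, x i) * ∑ i, invMod F (x i) =
      Ideal.Quotient.mk (Ideal.span {F}) (recipNumerator x) := by
  have hu : ∀ i, IsUnit (Ideal.Quotient.mk (Ideal.span {F}) (x i)) := by
    intro i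
    obtain ⟨a, b, h⟩ := hx i
    refine IsUnit.of_mul_eq_one (Ideal.Quotient.mk _ a) ?_
    rw [← map_mul, ← map_one (Ideal.Quotient.mk (Ideal.span {F})), Ideal.Quotient.eq,
      Ideal.mem_span_singleton]
    exact ⟨-b, by linear_combination h⟩
  rw [recipNumerator, map_sum, Finset.mul_sum]
  refine Finset.sum_congr rfl fun i _ => ?_
  rw [← Finset.mul_prod_erase _ _ (Finset.mem_univ i), map_mul, mul_comm, ← mul_assoc, invMod,
    Ring.inverse_mul_cancel _ (hu i), one_mul]

/-- A congruence between sums of inverses, with the denominators cleared. -/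
theorem dvd_crossLeft_of_sum_invMod_eq {K : Type*} [Field K] {F : K[X]} {k : ℕ}
    {x y : Fin k → K[X]} (hx : ∀ i, IsCoprime (x i) F) (hy : ∀ i, IsCoprime (y i) F)
    (h : ∑ i, invMod F (x i) = ∑ i, invMod F (y i)) :
    F ∣ crossLeft (recipNumerator x, ∏ i, x i) (recipNumerator y, ∏ i, y i) := by
  rw [crossLeft_apply, ← Ideal.mem_span_singleton, ← Ideal.Quotient.eq, map_mul, map_mul,
    ← mk_prod_mul_sum_invMod hx, ← mk_prod_mul_sum_invMod hy, h]
  ring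

/-- A prime dividing one of the `x i` and the numerator of `∑ i, 1 / x i` divides two of them. -/
theorem sq_dvd_prod_of_dvd_recipNumerator {R : Type*} [CommRing R] {p : R} (hp : Prime p)
    {k : ℕ} {x : Fin k → R} (h : p ∣ ∏ i, x i) (h' : p ∣ recipNumerator x) :
    p ^ 2 ∣ ∏ i, x i := by
  obtain ⟨i, -, hi⟩ := (hp.dvd_finsetProd_iff _).1 h
  rw [recipNumerator, ← Finset.add_sum_erase _ _ (Finset.mem_univ i)] at h'
  -- Every term of the numerator except the `i`-th contains `x i`, so `p` must also divide the
  -- product of the other variables.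
  have h2 : p ∣ ∑ l ∈ Finset.univ.erase i, ∏ j ∈ Finset.univ.erase l, x j := by
    refine Finset.dvd_sum fun l hl => hi.trans (Finset.dvd_prod_of_mem _ ?_)
    exact Finset.mem_erase.2 ⟨(Finset.ne_of_mem_erase hl).symm, Finset.mem_univ _⟩
  have h3 := (dvd_add_left h2).1 h'
  rw [← Finset.mul_prod_erase _ _ (Finset.mem_univ i), sq]
  exact mul_dvd_mul hi h3

/-- If two sums of reciprocals agree, the product of all the denominators is squarefull. -/
theorem sq_dvd_of_crossLeft_eq_zero {K : Type*} [Field K] {k : ℕ} {x y : Fin k → K[X]}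
    (h : crossLeft (recipNumerator x, ∏ i, x i) (recipNumerator y, ∏ i, y i) = 0)
    {p : K[X]} (hp : Prime p) (hdvd : p ∣ (∏ i, x i) * ∏ i, y i) :
    p ^ 2 ∣ (∏ i, x i) * ∏ i, y i := by
  rw [crossLeft_apply, sub_eq_zero] at h
  by_cases hx : p ∣ ∏ i, x i
  · by_cases hy : p ∣ ∏ i, y i
    · rw [sq]; exact mul_dvd_mul hx hy
    · have : p ∣ recipNumerator x * ∏ i, y i := h ▸ hx.mul_right _
      exact (sq_dvd_prod_of_dvd_recipNumerator hp hx
        ((hp.dvd_or_dvd this).resolve_right hy)).mul_right _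
  · have hy := (hp.dvd_or_dvd hdvd).resolve_left hx
    have : p ∣ (∏ i, x i) * recipNumerator y := h ▸ hy.mul_left _
    exact (sq_dvd_prod_of_dvd_recipNumerator hp hy
      ((hp.dvd_or_dvd this).resolve_left hx)).mul_left _

-- Take `A` of maximal degree with `A ^ 2 ∣ P`; maximality makes the cofactor `B` squarefree. A
-- prime of `B` not dividing `A` would have its square coprime to `A ^ 2`, hence dividing `B`.
open UniqueFactorizationMonoid in
theorem exists_sq_mul_of_squarefull {K : Type*} [Field K] {P : K[X]} (hP : P ≠ 0)
    (h : ∀ p : K[X], Prime p → p ∣ P → p ^ 2 ∣ P) :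
    ∃ A B : K[X], P = A ^ 2 * B ∧ B ∣ A := by
  classical
  let Q : ℕ → Prop := fun n => ∃ A : K[X], A ^ 2 ∣ P ∧ A.natDegree = n
  have hQ1 : Q 0 := ⟨1, by simp, by simp⟩
  have hbd : ∀ n, Q n → n ≤ P.natDegree := by
    rintro n ⟨A, hA, rfl⟩
    exact natDegree_le_of_dvd ((dvd_pow_self A two_ne_zero).trans hA) hP
  obtain ⟨A, ⟨B, rfl⟩, hA⟩ : Q (Nat.findGreatest Q P.natDegree) :=
    Nat.findGreatest_spec (P := Q) (Nat.zero_le _) hQ1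
  have hA0 : A ≠ 0 := by rintro rfl; simp at hP
  have hB0 : B ≠ 0 := right_ne_zero_of_mul hP
  have hmax : ∀ p : K[X], Prime p → ¬ p ^ 2 ∣ B := by
    intro p hp hpB
    have hQ : Q (A * p).natDegree := ⟨A * p, by rw [mul_pow]; exact mul_dvd_mul_left _ hpB, rfl⟩
    have := Nat.le_findGreatest (hbd _ hQ) hQ
    rw [natDegree_mul hA0 hp.ne_zero, ← hA] at this
    have := hp.irreducible.natDegree_pos
    omega
  have hsq : Squarefree B := by
    rw [squarefree_iff_no_irreducibles hB0]
    intro p hp hpB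
    exact hmax p hp.prime (by rwa [sq])
  refine ⟨A, B, rfl, ?_⟩
  rw [dvd_iff_normalizedFactors_le_normalizedFactors hB0 hA0,
    Multiset.le_iff_subset ((squarefree_iff_nodup_normalizedFactors hB0).1 hsq)]
  intro p hp
  have hprime := prime_of_normalized_factor p hp
  have hpA : p ∣ A := by
    by_contra hpA
    refine hmax p hprime ?_
    have h2 := h p hprime ((dvd_of_mem_normalizedFactors hp).mul_left _)
    have hcop : IsCoprime (p ^ 2) (A ^ 2) :=
      IsCoprime.pow ((hprime.irreducible.coprime_iff_not_dvd).2 hpA)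
    exact hcop.dvd_of_dvd_mul_left h2
  rw [mem_normalizedFactors_iff' hA0]
  exact ⟨hprime.irreducible, normalize_normalized_factor p hp, hpA⟩

/-! ### Counting the solutions in `K(T)`. -/

theorem ncard_le_mul_of_mapsTo {α β : Type*} {s : Set α} {t : Set β} (f : α → β)
    (hs : s.Finite) (ht : t.Finite) (hf : ∀ a ∈ s, f a ∈ t) {n : ℕ}
    (hn : ∀ b ∈ t, {a ∈ s | f a = b}.ncard ≤ n) : s.ncard ≤ t.ncard * n := by
  classical
  rw [Set.ncard_eq_toFinset_card _ hs, Set.ncard_eq_toFinset_card _ ht, mul_comm]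
  refine Finset.card_le_mul_card_image_of_maps_to (f := f) (by simpa using hf) n fun b hb => ?_
  rw [← Set.ncard_coe_finset]
  convert hn b (by simpa using hb) using 2
  ext a; simp

theorem ncard_univ_pi_const {α : Type*} (k : ℕ) (s : Set α) :
    (Set.univ.pi fun _ : Fin k => s).ncard = s.ncard ^ k := by
  rw [Set.ncard, Set.encard_pi_eq_prod_encard, Finset.prod_const, Finset.card_univ,
    Fintype.card_fin]
  exact map_pow ENat.toNatHom s.encard k

theorem natDegree_prod_le_of_polyInterval {K : Type*} [Field K] {m : ℕ}
    {ι : Type*} (s : Finset ι) {x : ι → K[X]} (h0 : ∀ i, x i ≠ 0)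
    (h : ∀ i, x i ∈ polyInterval K m) :
    (∏ i ∈ s, x i).natDegree ≤ s.card * (m - 1) := by
  rw [natDegree_prod _ _ fun i _ => h0 i]
  refine Finset.sum_le_card_nsmul _ _ _ fun i _ => ?_
  have := natDegree_lt_of_mem_polyInterval (h0 i) (h i)
  omega

/-- The solutions of `∑ 1 / x i = ∑ 1 / y i` in `K(T)` with `x i, y i` nonzero of degree `< m`. -/
theorem ncard_crossLeft_eq_zero_le {K : Type*} [Field K] [Finite K] {k m d : ℕ} (hk : 0 < k)
    (hm : 0 < m)
    (hd : ∀ A : K[X], A ≠ 0 → A.natDegree ≤ 3 * k * m → {D | D ∣ A}.ncard ≤ d)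
    {S : Set ((Fin k → K[X]) × (Fin k → K[X]))}
    (hSx : ∀ p ∈ S, ∀ i, p.1 i ∈ polyInterval K m ∧ p.1 i ≠ 0)
    (hSy : ∀ p ∈ S, ∀ i, p.2 i ∈ polyInterval K m ∧ p.2 i ≠ 0)
    (hS : ∀ p ∈ S,
      crossLeft (recipNumerator p.1, ∏ i, p.1 i) (recipNumerator p.2, ∏ i, p.2 i) = 0) :
    S.ncard ≤ Nat.card K ^ (k * m) * (d * (d ^ k * d ^ k)) := by
  have hfin : S.Finite := by
    have h : (Set.univ.pi fun _ : Fin k => polyInterval K m).Finite :=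
      Set.Finite.pi fun _ => polyInterval_finite K m
    exact (h.prod h).subset fun p hp => ⟨fun i _ => (hSx p hp i).1, fun i _ => (hSy p hp i).1⟩
  have hprod0 : ∀ p ∈ S, (∏ i, p.1 i) * ∏ i, p.2 i ≠ 0 := fun p hp =>
    mul_ne_zero (Finset.prod_ne_zero_iff.2 fun i _ => (hSx p hp i).2)
      (Finset.prod_ne_zero_iff.2 fun i _ => (hSy p hp i).2)
  have hdeg : ∀ p ∈ S, ((∏ i, p.1 i) * ∏ i, p.2 i).natDegree ≤ 2 * (k * (m - 1)) := by
    intro p hp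
    have h1 := natDegree_prod_le_of_polyInterval Finset.univ (fun i => (hSx p hp i).2)
      (fun i => (hSx p hp i).1)
    have h2 := natDegree_prod_le_of_polyInterval Finset.univ (fun i => (hSy p hp i).2)
      (fun i => (hSy p hp i).1)
    rw [Finset.card_univ, Fintype.card_fin] at h1 h2
    exact natDegree_mul_le.trans (by omega)
  have hex : ∀ p : (Fin k → K[X]) × (Fin k → K[X]), ∃ A B : K[X], p ∈ S →
      (∏ i, p.1 i) * ∏ i, p.2 i = A ^ 2 * B ∧ B ∣ A := by
    intro p
    by_cases hp : p ∈ S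
    · obtain ⟨A, B, h⟩ := exists_sq_mul_of_squarefull (hprod0 p hp)
        fun q hq => sq_dvd_of_crossLeft_eq_zero (hS p hp) hq
      exact ⟨A, B, fun _ => h⟩
    · exact ⟨0, 0, fun h => absurd h hp⟩
  choose A B hAB using hex
  have hA : ∀ p ∈ S, A p ∈ polyInterval K (k * m) ∧ A p ≠ 0 := by
    intro p hp
    have h0 := hprod0 p hp
    have hd := hdeg p hp
    rw [(hAB p hp).1] at h0 hd
    have hA0 : A p ≠ 0 := fun h => by simp [h] at h0
    refine ⟨mem_polyInterval_of_natDegree_lt ?_, hA0⟩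
    rw [natDegree_mul (pow_ne_zero _ hA0) (right_ne_zero_of_mul h0), natDegree_pow] at hd
    have : k * (m - 1) < k * m := Nat.mul_lt_mul_of_pos_left (by omega) hk
    omega
  rw [← ncard_polyInterval]
  refine (ncard_le_mul_of_mapsTo A (t := {a ∈ polyInterval K (k * m) | a ≠ 0}) hfin
    ((polyInterval_finite K _).subset (Set.sep_subset _ _)) hA ?_).trans
    (Nat.mul_le_mul_right _ (Set.ncard_le_ncard (Set.sep_subset _ _) (polyInterval_finite K _)))
  rintro a ⟨ha, ha0⟩
  have hdega := natDegree_lt_of_mem_polyInterval ha0 ha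
  have hdd : {D | D ∣ a}.ncard ≤ d := hd a ha0 (by nlinarith)
  refine (ncard_le_mul_of_mapsTo B (t := {D | D ∣ a}) (n := d ^ k * d ^ k)
    (hfin.subset (Set.sep_subset _ _)) (finite_dvd ha0) ?_ ?_).trans (Nat.mul_le_mul_right _ hdd)
  · rintro p ⟨hp, rfl⟩
    exact (hAB p hp).2
  · intro b hb
    have hb0 : b ≠ 0 := ne_zero_of_dvd_ne_zero ha0 hb
    have hne : a ^ 2 * b ≠ 0 := mul_ne_zero (pow_ne_zero _ ha0) hb0
    -- Since `b ∣ a` and `deg a < km`, the degree is below `3km`, the range in which `d` bounds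
    -- divisor counts.
    have hdb : {D | D ∣ a ^ 2 * b}.ncard ≤ d := by
      refine hd _ hne ?_
      rw [natDegree_mul (pow_ne_zero _ ha0) hb0, natDegree_pow]
      have := natDegree_le_of_dvd hb ha0
      nlinarith
    have hpi : (Set.univ.pi fun _ : Fin k => {D | D ∣ a ^ 2 * b}).Finite :=
      Set.Finite.pi fun _ => finite_dvd hne
    refine (Set.ncard_le_ncard (t := (Set.univ.pi fun _ : Fin k => {D | D ∣ a ^ 2 * b}) ×ˢ
      (Set.univ.pi fun _ : Fin k => {D | D ∣ a ^ 2 * b})) ?_ (hpi.prod hpi)).trans ?_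
    · rintro p ⟨⟨hp, rfl⟩, rfl⟩
      have h := (hAB p hp).1
      refine ⟨fun i _ => ?_, fun i _ => ?_⟩
      · exact h ▸ (Finset.dvd_prod_of_mem _ (Finset.mem_univ i)).mul_right _
      · exact h ▸ (Finset.dvd_prod_of_mem _ (Finset.mem_univ i)).mul_left _
    · rw [Set.ncard_prod, ncard_univ_pi_const]
      gcongr

/-! ### Counting the solutions modulo `F` that fail in `K(T)`. -/

theorem recipNumerator_mem_degreeLT {K : Type*} [Field K] {k m : ℕ} {x : Fin k → K[X]}
    (h0 : ∀ i, x i ≠ 0) (h : ∀ i, x i ∈ polyInterval K m) :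
    recipNumerator x ∈ degreeLT K ((k - 1) * (m - 1) + 1) := by
  refine mem_degreeLT_of_natDegree_lt fun _ => Nat.lt_succ_of_le ?_
  refine natDegree_sum_le_of_forall_le _ _ fun i _ => ?_
  have := natDegree_prod_le_of_polyInterval (Finset.univ.erase i) h0 h
  rwa [Finset.card_erase_of_mem (Finset.mem_univ i), Finset.card_univ, Fintype.card_fin] at this

theorem prod_mem_degreeLT {K : Type*} [Field K] {k m : ℕ} {x : Fin k → K[X]}
    (h0 : ∀ i, x i ≠ 0) (h : ∀ i, x i ∈ polyInterval K m) :
    ∏ i, x i ∈ degreeLT K (k * (m - 1) + 1) := by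
  refine mem_degreeLT_of_natDegree_lt fun _ => Nat.lt_succ_of_le ?_
  simpa using natDegree_prod_le_of_polyInterval Finset.univ h0 h

/-- The vectors `p` in a box with `p₁ / p₂ ≡ w₁ / w₂` modulo `F`. -/
noncomputable def proportionalBox {K : Type*} [Field K] (F : K[X]) (u v : ℕ) (w : K[X] × K[X]) :
    Submodule K (K[X] × K[X]) :=
  (degreeLT K u).prod (degreeLT K v) ⊓
    ((Ideal.span {F}).restrictScalars K).comap (crossLeft w)

theorem mem_proportionalBox {K : Type*} [Field K] {F : K[X]} {u v : ℕ} {w p : K[X] × K[X]} :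
    p ∈ proportionalBox F u v w ↔
      (p.1 ∈ degreeLT K u ∧ p.2 ∈ degreeLT K v) ∧ F ∣ crossLeft w p := by
  simp [proportionalBox, Ideal.mem_span_singleton]

/-- As `w.2` is invertible modulo `F`, two vectors proportional to `w` modulo `F` are proportional
to each other modulo `F`. All determinants are thus divisible by `F`, and `w`, `p` are two
non-proportional points of the box. -/
theorem finrank_proportionalBox_add_natDegree_le {K : Type*} [Field K] {F : K[X]} (hF : F ≠ 0)
    {u v : ℕ} {w p : K[X] × K[X]} (hw1 : w.1 ∈ degreeLT K u) (hw2 : w.2 ∈ degreeLT K v)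
    (hcop : IsCoprime w.2 F) (hp : p ∈ proportionalBox F u v w) (hne : crossLeft w p ≠ 0) :
    Module.finrank K (proportionalBox F u v w) + F.natDegree ≤ u + v := by
  refine finrank_add_natDegree_le hF _ (fun q hq => (mem_proportionalBox.1 hq).1) ?_
    ⟨w, mem_proportionalBox.2 ⟨⟨hw1, hw2⟩, ?_⟩, p, hp, hne⟩
  · intro a ha b hb
    refine hcop.symm.dvd_of_dvd_mul_left (z := crossLeft a b) ?_
    have h1 := (mem_proportionalBox.1 ha).2
    have h2 := (mem_proportionalBox.1 hb).2
    rw [crossLeft_apply] at h1 h2 ⊢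
    have h3 := dvd_sub (h2.mul_right a.2) (h1.mul_right b.2)
    refine h3.trans (dvd_of_eq ?_)
    ring
  · rw [crossLeft_apply, mul_comm, sub_self]
    exact dvd_zero _

theorem finite_proportionalBox {K : Type*} [Field K] [Finite K] (F : K[X]) (u v : ℕ)
    (w : K[X] × K[X]) : (proportionalBox F u v w : Set (K[X] × K[X])).Finite := by
  refine ((polyInterval_finite K u).prod (polyInterval_finite K v)).subset fun p hp => ?_
  have := (mem_proportionalBox.1 hp).1
  exact ⟨mem_degreeLT.1 this.1, mem_degreeLT.1 this.2⟩

/-- By the divisor bound, few tuples `y` share the same value of `∑ i, 1 / y i`, given as a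
fraction with denominator `∏ i, y i`. -/
theorem ncard_le_of_mem_submodule {K : Type*} [Field K] [Finite K] {k v d : ℕ}
    {L : Submodule K (K[X] × K[X])} (hLfin : (L : Set (K[X] × K[X])).Finite)
    (hL : ∀ p ∈ L, p.2 ∈ degreeLT K v)
    (hd : ∀ A : K[X], A ≠ 0 → A.natDegree < v → {D | D ∣ A}.ncard ≤ d)
    {x : Fin k → K[X]} {T : Set ((Fin k → K[X]) × (Fin k → K[X]))}
    (hT : ∀ p ∈ T, (recipNumerator p.2, ∏ i, p.2 i) ∈ L) (hT0 : ∀ p ∈ T, ∀ i, p.2 i ≠ 0)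
    (hTx : ∀ p ∈ T, p.1 = x) :
    T.ncard ≤ Nat.card K ^ Module.finrank K L * d ^ k := by
  have hLcard : (L : Set (K[X] × K[X])).ncard = Nat.card K ^ Module.finrank K L := by
    have : Finite L := hLfin
    rw [← Nat.card_coe_set_eq]
    exact Module.natCard_eq_pow_finrank
  rw [← hLcard]
  have hsep : {p ∈ (L : Set (K[X] × K[X])) | p.2 ≠ 0} ⊆ L := Set.sep_subset _ _
  have hpi : ∀ b : K[X], b ≠ 0 →
      ({x} ×ˢ (Set.univ.pi fun _ : Fin k => {D | D ∣ b})).Finite := fun b hb =>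
    (Set.finite_singleton _).prod (Set.Finite.pi fun _ => finite_dvd hb)
  have hsub : ∀ p ∈ T, p ∈ {x} ×ˢ (Set.univ.pi fun _ : Fin k => {D | D ∣ ∏ i, p.2 i}) :=
    fun p hp => ⟨hTx p hp, fun i _ => Finset.dvd_prod_of_mem _ (Finset.mem_univ i)⟩
  have hmaps : ∀ p ∈ T, (recipNumerator p.2, ∏ i, p.2 i) ∈
      {p ∈ (L : Set (K[X] × K[X])) | p.2 ≠ 0} :=
    fun p hp => ⟨hT p hp, (Finset.prod_ne_zero_iff.2 fun i _ => hT0 p hp i : ∏ i, p.2 i ≠ 0)⟩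
  have hTfin : T.Finite := by
    refine ((hLfin.subset hsep).biUnion fun b hb => hpi b.2 hb.2).subset fun p hp => ?_
    exact Set.mem_biUnion (hmaps p hp) (hsub p hp)
  refine (ncard_le_mul_of_mapsTo (fun p => (recipNumerator p.2, ∏ i, p.2 i)) hTfin
    (hLfin.subset hsep) hmaps (n := d ^ k) ?_).trans
    (Nat.mul_le_mul_right _ (Set.ncard_le_ncard hsep hLfin))
  rintro b ⟨hbL, hb0⟩
  have hdb := hd _ hb0 (natDegree_lt_of_mem_degreeLT (hL b hbL) hb0)
  refine (Set.ncard_le_ncard (t := {x} ×ˢ (Set.univ.pi fun _ : Fin k => {D | D ∣ b.2})) ?_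
    (hpi _ hb0)).trans ?_
  · rintro p ⟨hp, rfl⟩
    exact hsub p hp
  · rw [Set.ncard_prod, ncard_univ_pi_const, Set.ncard_singleton, one_mul]
    exact Nat.pow_le_pow_left hdb k

/-- The solutions modulo `F` of `∑ 1 / x i = ∑ 1 / y i` that are not solutions in `K(T)`. -/
theorem ncard_crossLeft_ne_zero_mul_le {K : Type*} [Field K] [Finite K] {F : K[X]} (hF : F ≠ 0)
    {k m d u v : ℕ} (hu : u = (k - 1) * (m - 1) + 1) (hv : v = k * (m - 1) + 1)
    (hd : ∀ A : K[X], A ≠ 0 → A.natDegree ≤ 3 * k * m → {D | D ∣ A}.ncard ≤ d)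
    {S : Set ((Fin k → K[X]) × (Fin k → K[X]))}
    (hSx : ∀ p ∈ S, ∀ i, p.1 i ∈ polyInterval K m ∧ p.1 i ≠ 0)
    (hSy : ∀ p ∈ S, ∀ i, p.2 i ∈ polyInterval K m ∧ p.2 i ≠ 0)
    (hcop : ∀ p ∈ S, ∀ i, IsCoprime (p.1 i) F)
    (hdvd : ∀ p ∈ S,
      F ∣ crossLeft (recipNumerator p.1, ∏ i, p.1 i) (recipNumerator p.2, ∏ i, p.2 i))
    (hS : ∀ p ∈ S,
      crossLeft (recipNumerator p.1, ∏ i, p.1 i) (recipNumerator p.2, ∏ i, p.2 i) ≠ 0) :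
    S.ncard * Nat.card K ^ F.natDegree ≤
      Nat.card K ^ (k * m) *
        (Nat.card K ^ (u + v) * d ^ k) := by
  have hpiI : (Set.univ.pi fun _ : Fin k => polyInterval K m).Finite :=
    Set.Finite.pi fun _ => polyInterval_finite K m
  have hfin : S.Finite :=
    (hpiI.prod hpiI).subset fun p hp => ⟨fun i _ => (hSx p hp i).1, fun i _ => (hSy p hp i).1⟩
  have hx1 : ∀ p ∈ S, recipNumerator p.1 ∈ degreeLT K u := fun p hp => by
    rw [hu]
    exact recipNumerator_mem_degreeLT (fun i => (hSx p hp i).2) fun i => (hSx p hp i).1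
  have hx2 : ∀ p ∈ S, ∏ i, p.1 i ∈ degreeLT K v := fun p hp => by
    rw [hv]
    exact prod_mem_degreeLT (fun i => (hSx p hp i).2) fun i => (hSx p hp i).1
  have hy1 : ∀ p ∈ S, recipNumerator p.2 ∈ degreeLT K u := fun p hp => by
    rw [hu]
    exact recipNumerator_mem_degreeLT (fun i => (hSy p hp i).2) fun i => (hSy p hp i).1
  have hy2 : ∀ p ∈ S, ∏ i, p.2 i ∈ degreeLT K v := fun p hp => by
    rw [hv]
    exact prod_mem_degreeLT (fun i => (hSy p hp i).2) fun i => (hSy p hp i).1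
  have hx3 : ∀ p ∈ S, IsCoprime (∏ i, p.1 i) F := fun p hp =>
    IsCoprime.prod_left fun i _ => hcop p hp i
  have hbox : ∀ p ∈ S, (recipNumerator p.2, ∏ i, p.2 i) ∈
      proportionalBox F u v (recipNumerator p.1, ∏ i, p.1 i) := fun p hp =>
    mem_proportionalBox.2 ⟨⟨hy1 p hp, hy2 p hp⟩, hdvd p hp⟩
  have hrank : ∀ p ∈ S, Module.finrank K
      (proportionalBox F u v (recipNumerator p.1, ∏ i, p.1 i)) + F.natDegree ≤ u + v :=
    fun p hp => finrank_proportionalBox_add_natDegree_le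
      (w := (recipNumerator p.1, ∏ i, p.1 i)) (p := (recipNumerator p.2, ∏ i, p.2 i))
      hF (hx1 p hp) (hx2 p hp) (hx3 p hp) (hbox p hp) (hS p hp)
  rcases S.eq_empty_or_nonempty with hemp | ⟨p₀, hp₀⟩
  · simp [hemp]
  have hr : F.natDegree ≤ u + v := (Nat.le_add_left _ _).trans (hrank p₀ hp₀)
  -- The factor `q ^ deg F` is cancelled only once `S` is nonempty, since this gives `deg F ≤ u +
  -- v`.
  suffices S.ncard ≤ Nat.card K ^ (k * m) * (Nat.card K ^ (u + v - F.natDegree) * d ^ k) by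
    refine (Nat.mul_le_mul_right _ this).trans_eq ?_
    have hpow : Nat.card K ^ (u + v) =
        Nat.card K ^ (u + v - F.natDegree) * Nat.card K ^ F.natDegree := by
      rw [← pow_add, Nat.sub_add_cancel hr]
    rw [hpow]
    ring
  have hcard : (Set.univ.pi fun _ : Fin k => polyInterval K m).ncard = Nat.card K ^ (k * m) := by
    rw [ncard_univ_pi_const, ncard_polyInterval, ← pow_mul, mul_comm]
  rw [← hcard]
  refine ncard_le_mul_of_mapsTo Prod.fst hfin hpiI (fun p hp i _ => (hSx p hp i).1) ?_
  intro x _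
  rcases Set.eq_empty_or_nonempty {p ∈ S | p.1 = x} with hemp | ⟨p₁, hp₁, rfl⟩
  · simp [hemp]
  refine (ncard_le_of_mem_submodule (L := proportionalBox F u v _) (v := v)
    (x := p₁.1) ?_ ?_ (d := d) ?_
    (T := {p ∈ S | p.1 = p₁.1}) ?_ ?_ ?_).trans (Nat.mul_le_mul_right _
      (Nat.pow_le_pow_right Nat.card_pos (Nat.le_sub_of_add_le (hrank p₁ hp₁))))
  · exact finite_proportionalBox _ _ _ _
  · exact fun p hp => (mem_proportionalBox.1 hp).1.2
  · intro A hA0 hA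
    refine hd A hA0 ?_
    have hkm : k * (m - 1) ≤ k * m := Nat.mul_le_mul_left _ (Nat.sub_le _ _)
    rw [hv] at hA
    nlinarith
  · rintro p ⟨hp, hpx⟩
    rw [← hpx]
    exact hbox p hp
  · exact fun p hp i => (hSy p hp.1 i).2
  · exact fun p hp => hp.2

/-! ### Combining the two counts. -/

theorem invEnergy_le {K : Type*} [Field K] [Finite K] {F : K[X]} (hF : 0 < F.natDegree)
    {k m d : ℕ} (hk : 0 < k) (hm : 0 < m)
    (hd : ∀ A : K[X], A ≠ 0 → A.natDegree ≤ 3 * k * m → {D | D ∣ A}.ncard ≤ d) :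
    ∃ a b : ℕ, invEnergy F k (polyInterval K m) ≤ a + b ∧
      a ≤ Nat.card K ^ (k * m) * (d * (d ^ k * d ^ k)) ∧
      b * Nat.card K ^ F.natDegree ≤ Nat.card K ^ (k * m) *
        (Nat.card K ^ ((k - 1) * (m - 1) + 1 + (k * (m - 1) + 1)) * d ^ k) := by
  have hF0 : F ≠ 0 := by rintro rfl; simp at hF
  set S := invSolutions F k (polyInterval K m)
  let c : (Fin k → K[X]) × (Fin k → K[X]) → K[X] := fun p =>
    crossLeft (recipNumerator p.1, ∏ i, p.1 i) (recipNumerator p.2, ∏ i, p.2 i)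
  -- As `F` is not constant, `0` is not coprime to it.
  have hne : ∀ x : K[X], IsCoprime x F → x ≠ 0 := by
    rintro x h rfl
    rw [isCoprime_zero_left] at h
    exact hF.ne' (natDegree_eq_zero_of_isUnit h)
  have hSx : ∀ p ∈ S, ∀ i, p.1 i ∈ polyInterval K m ∧ p.1 i ≠ 0 :=
    fun p hp i => ⟨(hp.1 i).1, hne _ (hp.1 i).2⟩
  have hSy : ∀ p ∈ S, ∀ i, p.2 i ∈ polyInterval K m ∧ p.2 i ≠ 0 :=
    fun p hp i => ⟨(hp.2.1 i).1, hne _ (hp.2.1 i).2⟩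
  refine ⟨{p ∈ S | c p = 0}.ncard, {p ∈ S | c p ≠ 0}.ncard, ?_, ?_, ?_⟩
  · have hunion : S = {p ∈ S | c p = 0} ∪ {p ∈ S | c p ≠ 0} := by
      ext p
      simp only [Set.mem_union, Set.mem_ofPred_eq]
      tauto
    exact (congrArg Set.ncard hunion).le.trans (Set.ncard_union_le _ _)
  · exact ncard_crossLeft_eq_zero_le hk hm hd (fun p hp => hSx p hp.1) (fun p hp => hSy p hp.1)
      fun p hp => hp.2
  · exact ncard_crossLeft_ne_zero_mul_le hF0 rfl rfl hd (fun p hp => hSx p hp.1)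
      (fun p hp => hSy p hp.1) (fun p hp i => (hp.1.1 i).2)
      (fun p hp => dvd_crossLeft_of_sum_invMod_eq (fun i => (hp.1.1 i).2)
        (fun i => (hp.1.2.1 i).2) hp.1.2.2) fun p hp => hp.2

theorem theorem2p3 (K : Type*) [Field K] [Finite K] (k : ℕ) (hk : 0 < k) :
    ∃ e : ℕ → ℝ, e =o[atTop] (fun m : ℕ => (m : ℝ)) ∧
      ∀ (F : K[X]) (r m : ℕ), F.degree = (r : WithBot ℕ) → 0 < m → m ≤ r →
        (invEnergy F k (polyInterval K m) : ℝ) ≤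
          (Nat.card K : ℝ) ^ ((k : ℝ) * (m : ℝ) + e m) +
            (Nat.card K : ℝ) ^ ((m : ℝ) * (3 * (k : ℝ) - 1) - (r : ℝ) + e m) := by
  obtain ⟨g, hg0, hgo, hg⟩ := exists_divisor_bound K
  have hq1 : (1 : ℝ) < Nat.card K := by exact_mod_cast (Finite.one_lt_card : 1 < Nat.card K)
  have hq0 : (0 : ℝ) < Nat.card K := by linarith
  -- The solutions in `K(T)` cost `2k + 1` divisor bounds, the others only `k`. For the latter, `km
  -- + u + v = m(3k - 1) + 3 - 2k`, and the `+ 1` covers `3 - 2k ≤ 1`.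
  refine ⟨fun m => (2 * k + 1) * g (3 * k * m) + 1, ?_, ?_⟩
  · refine IsLittleO.add (IsLittleO.const_mul_left ?_ _) ?_
    · have h1 : Tendsto (fun m : ℕ => 3 * k * m) atTop atTop :=
        tendsto_id.const_mul_atTop' (by omega)
      refine (hgo.comp_tendsto h1).trans_isBigO ?_
      simp only [Function.comp_def, Nat.cast_mul]
      exact (isBigO_refl _ _).const_mul_left _
    · exact (isLittleO_const_id_atTop (1 : ℝ)).comp_tendsto tendsto_natCast_atTop_atTop
  intro F r m hFr hm hmr
  have hFr' : F.natDegree = r := natDegree_eq_of_degree_eq_some hFr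
  set G := g (3 * k * m) with hG
  have hG0 : 0 ≤ G := hg0 _
  set q : ℝ := (Nat.card K : ℝ) with hqdef
  have hdq : ((⌊q ^ G⌋₊ : ℕ) : ℝ) ≤ q ^ G := Nat.floor_le (by positivity)
  set d := ⌊q ^ G⌋₊
  obtain ⟨a, b, hab, ha, hb⟩ := invEnergy_le (F := F) (by omega) hk hm (d := d)
    fun A hA hdeg => Nat.le_floor (hg A _ hA hdeg)
  have hkR : (1 : ℝ) ≤ k := by exact_mod_cast hk
  have hmR : (1 : ℝ) ≤ m := by exact_mod_cast hm
  refine (Nat.cast_le.2 hab).trans ?_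
  rw [Nat.cast_add]
  refine add_le_add ?_ ?_
  · have ha' : (a : ℝ) ≤ q ^ (k * m) * ((d : ℝ) * ((d : ℝ) ^ k * (d : ℝ) ^ k)) := by
      rw [hqdef]; exact_mod_cast ha
    refine ha'.trans ?_
    calc q ^ (k * m) * ((d : ℝ) * ((d : ℝ) ^ k * (d : ℝ) ^ k))
        ≤ q ^ (k * m) * (q ^ G * ((q ^ G) ^ k * (q ^ G) ^ k)) := by gcongr
      _ = q ^ ((k : ℝ) * m + (2 * k + 1) * G) := by
        rw [← Real.rpow_natCast q, ← Real.rpow_mul_natCast hq0.le, ← Real.rpow_add hq0,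
          ← Real.rpow_add hq0, ← Real.rpow_add hq0]
        congr 1
        push_cast
        ring
      _ ≤ _ := Real.rpow_le_rpow_of_exponent_le hq1.le (by linarith)
  · rw [hFr'] at hb
    have hb' : (b : ℝ) * q ^ r ≤ q ^ (k * m) *
        (q ^ ((k - 1) * (m - 1) + 1 + (k * (m - 1) + 1)) * (d : ℝ) ^ k) := by
      rw [hqdef]; exact_mod_cast hb
    rw [← le_div_iff₀ (by positivity)] at hb'
    refine hb'.trans ?_
    rw [div_le_iff₀ (by positivity)]
    calc q ^ (k * m) * (q ^ ((k - 1) * (m - 1) + 1 + (k * (m - 1) + 1)) * (d : ℝ) ^ k)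
        ≤ q ^ (k * m) * (q ^ ((k - 1) * (m - 1) + 1 + (k * (m - 1) + 1)) * (q ^ G) ^ k) := by
          gcongr
      _ = q ^ ((k : ℝ) * m + (((k : ℝ) - 1) * (m - 1) + 1 + (k * (m - 1) + 1) + G * k)) := by
        rw [← Real.rpow_natCast q, ← Real.rpow_natCast q, ← Real.rpow_mul_natCast hq0.le,
          ← Real.rpow_add hq0, ← Real.rpow_add hq0]
        congr 1
        push_cast [Nat.cast_sub hk, Nat.cast_sub hm]
        ring
      _ ≤ q ^ ((m : ℝ) * (3 * k - 1) - r + ((2 * k + 1) * G + 1) + r) := by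
        refine Real.rpow_le_rpow_of_exponent_le hq1.le ?_
        nlinarith [mul_nonneg hG0 (by linarith : (0 : ℝ) ≤ k)]
      _ = _ := by rw [Real.rpow_add hq0, Real.rpow_natCast]
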